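/- Let $G$ be a bounded Abelian group (that is, $mG=0$ for some positive integer $m$), let $\phi$ be an endomorphism of $G$, and let $H\le G$ be a $\phi$-invariant subgroup (that is, $\phi(H)\subseteq H$). Then $$\mathrm{ent}^\star(\phi)=\mathrm{ent}^\star(\phi\restriction_H)+\mathrm{ent}^\star(\overline\phi),$$ where $\overline\phi:G/H\to G/H$ is the endomorphism induced by $\phi$. Here, for an endomorphism $\psi$ of an Abelian group $A$, the adjoint algebraic entropy of $\psi$ is $$\mathrm{ent}^\star(\psi)=\sup\left\{\lim_{n\to\infty}\frac{\log\left|A/(N\cap\psi^{-1}N\cap\dots\cap\psi^{-(n-1)}N)\right|}{n} : N\le A,\ A/N\text{ finite}\right\}\in[0,\infty];$$ the limit exists and is a nonnegative real number for every subgroup $N$ of finite index. -/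

import Mathlib

namespace AdjointEntropy

variable {G : Type*} [AddCommGroup G]

/-- The subgroup `B_n(φ, N) = N ∩ φ⁻¹N ∩ ⋯ ∩ φ⁻⁽ⁿ⁻¹⁾N`. -/
def B (φ : G →+ G) (N : AddSubgroup G) (n : ℕ) : AddSubgroup G where
  carrier := {x | ∀ i < n, φ^[i] x ∈ N}
  zero_mem' := fun i _ => by rw [iterate_map_zero]; exact N.zero_mem
  add_mem' := fun hx hy i hi => by
    rw [iterate_map_add]; exact N.add_mem (hx i hi) (hy i hi)
  neg_mem' := fun hx i hi => by rw [iterate_map_neg]; exact N.neg_mem (hx i hi)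

/-- The `n`-th cotrajectory `C_n(φ, N) = G / B_n(φ, N)`. -/
abbrev C (φ : G →+ G) (N : AddSubgroup G) (n : ℕ) : Type _ :=
  G ⧸ B φ N n

/-- `log |C_n(φ, N)|`. -/
noncomputable def logCard (φ : G →+ G) (N : AddSubgroup G) (n : ℕ) : ℝ :=
  Real.log (Nat.card (C φ N n))

/-- `H⋆(φ, N) = lim_{n → ∞} log |C_n(φ, N)| / n`; for `N` of finite index the limit exists,
see `tendsto_Hstar`. -/
noncomputable def Hstar (φ : G →+ G) (N : AddSubgroup G) : ℝ :=
  Filter.limUnder Filter.atTop (fun n : ℕ => logCard φ N n / n)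

/-- The adjoint algebraic entropy `ent⋆(φ)`, the supremum in `[0, ∞]` of the numbers
`H⋆(φ, N)` (they are nonnegative, see `Hstar_nonneg`) over all subgroups `N` of finite index. -/
noncomputable def entStar (φ : G →+ G) : ENNReal :=
  ⨆ (N : AddSubgroup G) (_ : N.FiniteIndex), ENNReal.ofReal (Hstar φ N)

/-- `H` is `φ`-invariant: `φ H ⊆ H`. -/
def IsInvariant (φ : G →+ G) (H : AddSubgroup G) : Prop :=
  ∀ x ∈ H, φ x ∈ H

/-- The restriction of `φ` to an invariant subgroup. -/
def restrict (φ : G →+ G) (H : AddSubgroup G) (h : IsInvariant φ H) :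
    H →+ H :=
  (φ.comp H.subtype).codRestrict H (fun x => h x x.2)

/-- The endomorphism of `G / H` induced by `φ`. -/
def induced (φ : G →+ G) (H : AddSubgroup G) (h : IsInvariant φ H) :
    G ⧸ H →+ G ⧸ H :=
  QuotientAddGroup.map H H φ (fun x hx => h x hx)

/-- `G` is bounded: `m G = 0` for some positive integer `m`. -/
def IsBounded (G : Type*) [AddCommGroup G] : Prop :=
  ∃ m : ℕ, 0 < m ∧ ∀ x : G, m • x = 0

theorem mem_B {φ : G →+ G} {N : AddSubgroup G} {n : ℕ} {x : G} :
    x ∈ B φ N n ↔ ∀ i < n, φ^[i] x ∈ N := Iff.rfl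

theorem restrict_apply (φ : G →+ G) (H : AddSubgroup G) (h : IsInvariant φ H)
    (x : H) : (restrict φ H h x : G) = φ x := rfl

theorem induced_mk (φ : G →+ G) (H : AddSubgroup G) (h : IsInvariant φ H)
    (x : G) : induced φ H h (x : G ⧸ H) = (φ x : G ⧸ H) := rfl

/-- The `m`-th iterate of `φ`, as a homomorphism. -/
def iter (φ : G →+ G) (m : ℕ) : G →+ G where
  toFun := φ^[m]
  map_zero' := iterate_map_zero φ m
  map_add' := iterate_map_add φ m

theorem B_add (φ : G →+ G) (N : AddSubgroup G) (m n : ℕ) :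
    B φ N (m + n) = B φ N m ⊓ (B φ N n).comap (iter φ m) := by
  ext x
  have key : ∀ i, φ^[i] (φ^[m] x) = φ^[m + i] x := fun i => by
    rw [add_comm, Function.iterate_add_apply]
  rw [AddSubgroup.mem_inf, AddSubgroup.mem_comap, mem_B, mem_B, mem_B]
  change _ ↔ _ ∧ ∀ i < n, φ^[i] (φ^[m] x) ∈ N
  simp only [key]
  constructor
  · exact fun h => ⟨fun i hi => h i (by omega), fun i hi => h _ (by omega)⟩
  · rintro ⟨h1, h2⟩ i hi
    rcases lt_or_ge i m with him | him
    · exact h1 i him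
    · have := h2 (i - m) (by omega)
      rwa [Nat.add_sub_cancel' him] at this

theorem finiteIndex_B (φ : G →+ G) (N : AddSubgroup G) [N.FiniteIndex] (n : ℕ) :
    (B φ N n).FiniteIndex := by
  induction n with
  | zero =>
    have h : B φ N 0 = ⊤ := by ext x; simp [mem_B]
    rw [h]; infer_instance
  | succ k ih =>
    have h1 : B φ N 1 = N := by ext x; simp [mem_B]
    have h2 : (N.comap (iter φ k)).FiniteIndex := ⟨by
      rw [AddSubgroup.index_comap]
      exact ne_zero_of_dvd_ne_zero AddSubgroup.FiniteIndex.index_ne_zero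
        (AddSubgroup.relIndex_dvd_index_of_normal _ _)⟩
    rw [B_add, h1]; infer_instance

theorem subadditive_logCard (φ : G →+ G) (N : AddSubgroup G) [N.FiniteIndex] :
    Subadditive (logCard φ N) := by
  intro m n
  have hm := (finiteIndex_B φ N m).index_ne_zero
  have hn := (finiteIndex_B φ N n).index_ne_zero
  have hmn := (finiteIndex_B φ N (m + n)).index_ne_zero
  change Real.log ((B φ N (m + n)).index : ℝ) ≤
    Real.log ((B φ N m).index : ℝ) + Real.log ((B φ N n).index : ℝ)
  rw [← Real.log_mul (by exact_mod_cast hm) (by exact_mod_cast hn)]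
  refine Real.log_le_log (by exact_mod_cast Nat.pos_of_ne_zero hmn) ?_
  norm_cast
  rw [B_add]
  refine (AddSubgroup.index_inf_le).trans (Nat.mul_le_mul_left _ ?_)
  rw [AddSubgroup.index_comap]
  exact Nat.le_of_dvd (Nat.pos_of_ne_zero hn) (AddSubgroup.relIndex_dvd_index_of_normal _ _)

theorem logCard_nonneg (φ : G →+ G) (N : AddSubgroup G) (n : ℕ) :
    0 ≤ logCard φ N n :=
  Real.log_natCast_nonneg _

theorem tendsto_Hstar (φ : G →+ G) (N : AddSubgroup G) [N.FiniteIndex] :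
    Filter.Tendsto (fun n : ℕ => logCard φ N n / n) Filter.atTop (nhds (Hstar φ N)) := by
  refine tendsto_nhds_limUnder ⟨_, (subadditive_logCard φ N).tendsto_lim ⟨0, ?_⟩⟩
  rintro _ ⟨n, rfl⟩
  exact div_nonneg (logCard_nonneg φ N n) (Nat.cast_nonneg n)

theorem Hstar_nonneg (φ : G →+ G) (N : AddSubgroup G) [N.FiniteIndex] :
    0 ≤ Hstar φ N :=
  ge_of_tendsto' (tendsto_Hstar φ N)
    fun n => div_nonneg (logCard_nonneg φ N n) (Nat.cast_nonneg n)

end AdjointEntropy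

open Polynomial

namespace AdjointEntropy

/-! On a bounded group the entropy takes only the values 0 and ∞: it is 0 when some monic integer
polynomial kills `φ`, and ∞ otherwise. Additivity follows, since a monic annihilator of `φ` also
kills the restriction and the induced map, and conversely the product of monic annihilators of these
two kills `φ`.

If a monic `f` kills `φ`, iterates reduce modulo `f`, so `B φ N n` is eventually constant. If none
does, boundedness yields a prime `p` for which the map induced on `G/pG` is not algebraic over the
field with `p` elements. For a non-algebraic `T` over a finite field `K`, each `k` admits a linear
`χ` into `K^k` whose values along `T`-orbits can be prescribed freely; its kernel contributes
entropy `k log |K|`. -/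

theorem map_aeval_of_semiconj {R S A B : Type*} [CommRing R] [CommRing S] [AddCommGroup A]
    [AddCommGroup B] [Module R A] [Module S B] [Module R B] [Algebra R S] [IsScalarTower R S B]
    (h : A →ₗ[R] B) (α : Module.End R A) (β : Module.End S B)
    (hαβ : ∀ x, h (α x) = β (h x)) (f : R[X]) (x : A) :
    h (aeval α f x) = aeval β f (h x) := by
  induction f using Polynomial.induction_on generalizing x with
  | C a => simp [Module.algebraMap_end_apply]
  | add p q hp hq => simp [hp, hq]
  | monomial n a ih =>
    have := ih (α x)
    simpa [pow_succ, Module.algebraMap_end_apply, hαβ] using this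

/-! ### Non-algebraic endomorphisms over a finite field -/

section Algebraic

variable {K V : Type*} [Field K] [AddCommGroup V] [Module K V]

/-- By Cayley–Hamilton on the `T`-stable range of `Q(T)`, a characteristic polynomial times `Q`
kills `T`. -/
theorem exists_aeval_eq_zero_of_finiteDimensional_range (T : Module.End K V) {Q : K[X]}
    (hQ : Q ≠ 0) (hfin : FiniteDimensional K (aeval T Q).range) :
    ∃ f : K[X], f ≠ 0 ∧ aeval T f = 0 := by
  have hinv : ∀ x ∈ (aeval T Q).range, T x ∈ (aeval T Q).range := by
    rintro _ ⟨y, rfl⟩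
    refine ⟨T y, (map_aeval_of_semiconj T T T (fun _ => rfl) Q y).symm⟩
  have hP := LinearMap.charpoly_monic (T.restrict hinv)
  refine ⟨(T.restrict hinv).charpoly * Q, mul_ne_zero hP.ne_zero hQ, LinearMap.ext fun x => ?_⟩
  have h := map_aeval_of_semiconj (aeval T Q).range.subtype (T.restrict hinv) T (fun _ => rfl)
    (T.restrict hinv).charpoly ⟨aeval T Q x, x, rfl⟩
  rw [LinearMap.aeval_self_charpoly] at h
  simpa using h.symm

theorem exists_forall_aeval_notMem [Finite K] (T : Module.End K V)
    (hT : ∀ f : K[X], f ≠ 0 → aeval T f ≠ 0) (F : Submodule K V) [FiniteDimensional K F] (d : ℕ) :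
    ∃ v, ∀ g ∈ degreeLT K d, aeval T g v ∈ F → g = 0 := by
  classical
  by_contra! hcon
  have hfinite : (degreeLT K d : Set K[X]).Finite :=
    have : Finite (degreeLT K d) := Finite.of_equiv _ (degreeLTEquiv K d).toEquiv.symm
    Set.toFinite _
  let S : Finset K[X] := hfinite.toFinset.erase 0
  -- If every `v` is sent into `F` by some nonzero `g` of degree below `d`, the product of all such
  -- `g`, finitely many as `K` is finite, sends `V` into this finite-dimensional space.
  let F' : Submodule K V := S.sup fun h => F.map (aeval T (∏ g ∈ S.erase h, g))
  have hF' : FiniteDimensional K F' := Submodule.finiteDimensional_finset_sup _ _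
  obtain ⟨f, hf, hf0⟩ := exists_aeval_eq_zero_of_finiteDimensional_range T (Q := ∏ g ∈ S, g)
    (Finset.prod_ne_zero_iff.2 fun g hg => Finset.ne_of_mem_erase hg) (by
      refine Submodule.finiteDimensional_of_le (S₂ := F') ?_
      rintro _ ⟨v, rfl⟩
      obtain ⟨g, hg, hgv, hg0⟩ := hcon v
      have hgS : g ∈ S := Finset.mem_erase.2 ⟨hg0, hfinite.mem_toFinset.2 hg⟩
      refine Finset.le_sup (f := fun h => F.map (aeval T (∏ g ∈ S.erase h, g))) hgS ?_
      refine ⟨_, hgv, ?_⟩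
      rw [← Finset.prod_erase_mul S _ hgS, map_mul, Module.End.mul_apply])
  exact hT f hf hf0

theorem linearIndependent_mkQ_pow_apply (T : Module.End K V) (F : Submodule K V) {d : ℕ} {v : V}
    (hv : ∀ g ∈ degreeLT K d, aeval T g v ∈ F → g = 0) :
    LinearIndependent K fun j : Fin d => F.mkQ ((T ^ (j : ℕ)) v) := by
  rw [Fintype.linearIndependent_iff]
  intro c hc
  have key : aeval T ((degreeLTEquiv K d).symm c : K[X]) v = ∑ j, c j • (T ^ (j : ℕ)) v := by
    simp [degreeLTEquiv, aeval_monomial, LinearMap.sum_apply, Module.algebraMap_end_apply]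
  have h0 := hv _ ((degreeLTEquiv K d).symm c).2 (by
    rw [key, ← Submodule.ker_mkQ F, LinearMap.mem_ker, ← hc]
    simp)
  have : c = 0 := by
    rw [← (degreeLTEquiv K d).apply_symm_apply c, show (degreeLTEquiv K d).symm c = 0 from Subtype.ext h0,
      map_zero]
  simp [this]

/-- Orbit segments are chosen one at a time, each independent modulo the span of the earlier ones.
-/
theorem exists_linearIndependent_sigma_pow_apply [Finite K] (T : Module.End K V)
    (hT : ∀ f : K[X], f ≠ 0 → aeval T f ≠ 0) (d : ℕ → ℕ) :
    ∃ v : ℕ → V, LinearIndependent K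
      fun i : Σ t, Fin (d t) => (T ^ (i.2 : ℕ)) (v i.1) := by
  classical
  let FD := {F : Submodule K V // FiniteDimensional K F}
  choose w hw using fun (F : FD) (n : ℕ) =>
    have := F.2
    exists_forall_aeval_notMem T hT F.1 n
  let blk (v : V) (n : ℕ) : Submodule K V :=
    Submodule.span K (Set.range fun j : Fin n => (T ^ (j : ℕ)) v)
  have hblk (v n) : FiniteDimensional K (blk v n) :=
    FiniteDimensional.span_of_finite K (Set.finite_range _)
  let seq : ℕ → FD := fun t =>
    Nat.rec ⟨⊥, inferInstance⟩ (fun t F => ⟨F.1 ⊔ blk (w F (d t)) (d t),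
      have := F.2
      Submodule.finiteDimensional_sup _ _⟩) t
  let v : ℕ → V := fun t => w (seq t) (d t)
  have hseq : ∀ t, (seq t).1 = (Finset.range t).sup fun s => blk (v s) (d s) := by
    intro t
    induction t with
    | zero => rfl
    | succ t ih => rw [Finset.range_add_one, Finset.sup_insert, ← ih, sup_comm]
  have hli t := linearIndependent_mkQ_pow_apply T _ (hw (seq t) (d t))
  have hdis : ∀ t, Disjoint (blk (v t) (d t)) (seq t).1 := by
    intro t
    simpa [blk, v] using Submodule.range_ker_disjoint (f := (seq t).1.mkQ)
      (v := fun j : Fin (d t) => (T ^ (j : ℕ)) (v t)) (hli t)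
  have hsup : ∀ t, (Finset.range t).SupIndep fun s => blk (v s) (d s) := by
    intro t
    induction t with
    | zero => simp
    | succ t ih =>
      rw [Finset.range_add_one]
      exact ih.insert (hseq t ▸ hdis t)
  refine ⟨v, linearIndependent_iUnion_finite (f := fun t (j : Fin (d t)) => (T ^ (j : ℕ)) (v t))
    (fun t => (hli t).of_comp (seq t).1.mkQ) fun i s hs hi => ?_⟩
  obtain ⟨n, hn⟩ := (insert i hs.toFinset).exists_nat_subset_range
  have := hsup n ((Finset.subset_insert _ _).trans hn) (hn (Finset.mem_insert_self _ _))
    (by simpa using hi)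
  rw [Finset.sup_eq_iSup] at this
  simpa using this

theorem exists_linearMap_forall_surjective [Finite K] (T : Module.End K V)
    (hT : ∀ f : K[X], f ≠ 0 → aeval T f ≠ 0) (k : ℕ) :
    ∃ χ : V →ₗ[K] (Fin k → K), ∀ n : ℕ,
      Function.Surjective fun (x : V) (j : Fin n) => χ ((T ^ (j : ℕ)) x) := by
  obtain ⟨v, hv⟩ := exists_linearIndependent_sigma_pow_apply T hT fun t => (k + 1) * t
  -- On the segment of `v t`, `χ` puts the `i`-th basis vector at position `(i + 1) * t - 1` and
  -- zeros elsewhere. Markers are `t` apart, so a window of length `t` meets at most one.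
  obtain ⟨χ, hχ⟩ : ∃ χ : V →ₗ[K] (Fin k → K), ∀ (t s : ℕ), s < (k + 1) * t →
      χ ((T ^ s) (v t)) = fun i : Fin k => if s + 1 = (i + 1) * t then 1 else 0 := by
    obtain ⟨χ, hχ⟩ := LinearMap.exists_extend ((Module.Basis.span hv).constr K
      fun (a : Σ t, Fin ((k + 1) * t)) (i : Fin k) =>
        if (a.2 : ℕ) + 1 = (i + 1) * a.1 then (1 : K) else 0)
    refine ⟨χ, fun t s hs => ?_⟩
    have h1 := (Module.Basis.span hv).constr_basis K (fun (a : Σ t, Fin ((k + 1) * t)) (i : Fin k) =>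
        if (a.2 : ℕ) + 1 = (i + 1) * a.1 then (1 : K) else 0) ⟨t, s, hs⟩
    rw [← hχ] at h1
    simpa [Module.Basis.span_apply] using h1
  refine ⟨χ, fun n => ?_⟩
  let Ψ : V →ₗ[K] (Fin n → Fin k → K) := LinearMap.pi fun j => χ.comp (T ^ (j : ℕ))
  suffices h : Function.Surjective Ψ from h
  intro y
  -- The shift places marker `i` at coordinate `j` of the window. Exponents stay below `(k + 1) *
  -- n`, which is why the segments have that length.
  refine ⟨∑ j : Fin n, ∑ i : Fin k, y j i • (T ^ (((i : ℕ) + 1) * n - 1 - (j : ℕ))) (v n), ?_⟩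
  have key (j : Fin n) (i : Fin k) :
      Ψ ((T ^ (((i : ℕ) + 1) * n - 1 - (j : ℕ))) (v n)) = Pi.single j (Pi.single i 1) := by
    have hj := j.2
    have hi : ((i : ℕ) + 1) * n ≤ k * n := Nat.mul_le_mul_right _ i.2
    have hi' : n ≤ ((i : ℕ) + 1) * n := Nat.le_mul_of_pos_left _ (by omega)
    funext j' i'
    have hj' := j'.2
    have : Ψ ((T ^ (((i : ℕ) + 1) * n - 1 - (j : ℕ))) (v n)) j' =
        χ ((T ^ ((j' : ℕ) + (((i : ℕ) + 1) * n - 1 - (j : ℕ)))) (v n)) := by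
      simp [Ψ, pow_add]
    rw [this, hχ _ _ (by
      have := add_one_mul k n
      omega)]
    have hiff : ((j' : ℕ) + (((i : ℕ) + 1) * n - 1 - (j : ℕ)) + 1 = ((i' : ℕ) + 1) * n) ↔ (j' = j ∧ i' = i) := by
      constructor
      · intro h
        have hii : (i' : ℕ) = i := by
          rcases lt_trichotomy (i' : ℕ) i with h1 | h1 | h1
          · have := Nat.mul_le_mul_right n (show (i' : ℕ) + 1 + 1 ≤ i + 1 by omega)
            rw [add_mul _ 1 n, one_mul] at this
            omega
          · exact h1
          · have := Nat.mul_le_mul_right n (show (i : ℕ) + 1 + 1 ≤ i' + 1 by omega)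
            rw [add_mul _ 1 n, one_mul] at this
            omega
        rw [hii] at h
        exact ⟨Fin.ext (by omega), Fin.ext hii⟩
      · rintro ⟨rfl, rfl⟩
        omega
    simp only [hiff]
    by_cases hjj : j' = j
    · subst hjj
      by_cases hii : i' = i
      · subst hii; simp
      · simp [hii]
    · simp [hjj]
  simp only [map_sum, map_smul, key]
  funext j i
  simp [Finset.sum_apply, Pi.single_apply, ite_apply]

end Algebraic


/-! ### The dichotomy between zero and infinite entropy -/

section Entropy

variable {G : Type*} [AddCommGroup G]

theorem toIntLinearMap_pow_apply (φ : G →+ G) (n : ℕ) (x : G) :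
    ((φ.toIntLinearMap : Module.End ℤ G) ^ n) x = φ^[n] x := by
  rw [Module.End.pow_apply]
  rfl

theorem Hstar_ker_of_surjective {A : Type*} [AddCommGroup A] [Finite A] (φ : G →+ G)
    (χ : G →+ A)
    (hχ : ∀ n : ℕ, Function.Surjective fun (x : G) (j : Fin n) => χ (φ^[j] x)) :
    Hstar φ χ.ker = Real.log (Nat.card A) := by
  have : χ.ker.FiniteIndex := AddSubgroup.finiteIndex_ker χ
  refine tendsto_nhds_unique (tendsto_Hstar φ χ.ker)
    (tendsto_const_nhds.congr' (Filter.eventually_atTop.2 ⟨1, fun n hn => ?_⟩))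
  let Ψ : G →+ (Fin n → A) := AddMonoidHom.pi fun j => χ.comp (iter φ j)
  have hB : B φ χ.ker n = Ψ.ker := by
    ext x
    rw [mem_B, AddMonoidHom.mem_ker, funext_iff, Fin.forall_iff]
    rfl
  have hcard : Nat.card (C φ χ.ker n) = Nat.card A ^ n := by
    change Nat.card (G ⧸ B φ χ.ker n) = _
    rw [hB, Nat.card_congr (QuotientAddGroup.quotientKerEquivOfSurjective Ψ (hχ n)).toEquiv]
    rw [Nat.card_fun, Nat.card_fin]
  change Real.log (Nat.card A) = Real.log (Nat.card (C φ χ.ker n)) / n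
  rw [hcard, Nat.cast_pow, Real.log_pow]
  field_simp

theorem Hstar_eq_zero_of_aeval_eq_zero (φ : G →+ G) {f : ℤ[X]} (hf : f.Monic)
    (h0 : aeval (φ.toIntLinearMap : Module.End ℤ G) f = 0) (N : AddSubgroup G) [N.FiniteIndex] :
    Hstar φ N = 0 := by
  have hB : ∀ n, f.natDegree + 1 ≤ n → B φ N n = B φ N (f.natDegree + 1) := by
    intro n hn
    refine le_antisymm (fun x hx i hi => hx i (hi.trans_le hn)) fun x hx i _ => ?_
    -- Division by the monic `f` writes `φ^[i] x` as an integer combination of boundedly many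
    -- iterates, all in `N`.
    have h1 : aeval (φ.toIntLinearMap : Module.End ℤ G) (X ^ i %ₘ f) x = φ^[i] x := by
      rw [aeval_modByMonic_eq_self_of_root h0, map_pow, aeval_X, toIntLinearMap_pow_apply]
    rw [← h1, aeval_eq_sum_range' (n := f.natDegree + 1)
      (Nat.lt_succ_of_le (natDegree_modByMonic_le _ hf)), LinearMap.sum_apply]
    refine N.sum_mem fun j hj => ?_
    rw [LinearMap.smul_apply, toIntLinearMap_pow_apply]
    exact N.zsmul_mem (hx j (Finset.mem_range.1 hj)) _
  refine tendsto_nhds_unique (tendsto_Hstar φ N)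
    ((tendsto_const_div_atTop_nhds_zero_nat (logCard φ N (f.natDegree + 1))).congr'
      (Filter.eventually_atTop.2 ⟨f.natDegree + 1, fun n hn => ?_⟩))
  simp only [logCard, C, hB n hn]

theorem entStar_eq_zero_of_aeval_eq_zero (φ : G →+ G) {f : ℤ[X]} (hf : f.Monic)
    (h0 : aeval (φ.toIntLinearMap : Module.End ℤ G) f = 0) : entStar φ = 0 := by
  simp only [entStar, ENNReal.iSup_eq_zero, ENNReal.ofReal_eq_zero]
  intro N _
  exact (Hstar_eq_zero_of_aeval_eq_zero φ hf h0 N).le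

theorem entStar_eq_top_of_semiconj {K V : Type*} [Field K] [Finite K] [AddCommGroup V] [Module K V]
    (φ : G →+ G) (T : Module.End K V) (q : G →+ V) (hq : Function.Surjective q)
    (hqT : ∀ x, q (φ x) = T (q x)) (hT : ∀ f : K[X], f ≠ 0 → aeval T f ≠ 0) :
    entStar φ = ⊤ := by
  have hlog : 0 < Real.log (Nat.card K) :=
    Real.log_pos (by exact_mod_cast Finite.one_lt_card)
  refine ENNReal.eq_top_of_forall_nnreal_le fun r => ?_
  obtain ⟨k, hk⟩ := exists_nat_ge (r / Real.log (Nat.card K))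
  obtain ⟨χ, hχ⟩ := exists_linearMap_forall_surjective T hT k
  have hiter : ∀ n x, q (φ^[n] x) = (T ^ n) (q x) := fun n x => by
    rw [Module.End.pow_apply]
    exact Function.Semiconj.iterate_right (f := q) hqT n x
  have hH := Hstar_ker_of_surjective φ (χ.toAddMonoidHom.comp q) fun n y => by
    obtain ⟨v, hv⟩ := hχ n y
    obtain ⟨x, rfl⟩ := hq v
    exact ⟨x, by simpa [hiter] using hv⟩
  refine le_trans ?_ (le_iSup₂ (f := fun (N : AddSubgroup G) (_ : N.FiniteIndex) =>
    ENNReal.ofReal (Hstar φ N)) (χ.toAddMonoidHom.comp q).ker (AddSubgroup.finiteIndex_ker _))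
  rw [hH, ← ENNReal.ofReal_coe_nnreal]
  refine ENNReal.ofReal_le_ofReal ?_
  rw [div_le_iff₀ hlog] at hk
  rwa [Nat.card_fun, Nat.card_fin, Nat.cast_pow, Real.log_pow]

/-- Composing polynomials that map `G` into `aG` and into `bG` gives one that maps `G` into `abG`.
When `mG = 0` this yields a monic annihilator, so without one some prime must fail. -/
theorem exists_monic_forall_aeval_eq_nsmul (φ : Module.End ℤ G)
    (h : ∀ p : ℕ, p.Prime → ∃ f : ℤ[X], f.Monic ∧ ∀ x, ∃ y, aeval φ f x = p • y)
    (m : ℕ) (hm : m ≠ 0) : ∃ f : ℤ[X], f.Monic ∧ ∀ x, ∃ y, aeval φ f x = m • y := by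
  induction m using Nat.recOnMul with
  | zero => exact absurd rfl hm
  | one => exact ⟨1, monic_one, fun x => ⟨x, by simp⟩⟩
  | prime p hp => exact h p hp
  | mul a b iha ihb =>
    obtain ⟨f, hf, hf'⟩ := iha (left_ne_zero_of_mul hm)
    obtain ⟨g, hg, hg'⟩ := ihb (right_ne_zero_of_mul hm)
    refine ⟨g * f, hg.mul hf, fun x => ?_⟩
    obtain ⟨y, hy⟩ := hf' x
    obtain ⟨z, hz⟩ := hg' y
    exact ⟨z, by rw [map_mul, Module.End.mul_apply, hy, map_nsmul, hz, mul_smul]⟩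

theorem exists_monic_int_aeval_eq_zero {p : ℕ} [Fact p.Prime] {V : Type*} [AddCommGroup V]
    [Module (ZMod p) V] (T : Module.End (ZMod p) V) {f : (ZMod p)[X]} (hf : f ≠ 0)
    (hf0 : aeval T f = 0) : ∃ g : ℤ[X], g.Monic ∧ aeval T g = 0 := by
  have hlift : f * Polynomial.C f.leadingCoeff⁻¹ ∈ lifts (Int.castRingHom (ZMod p)) :=
    (mem_lifts _).2 (map_surjective _ (ZMod.ringHom_surjective _) _)
  obtain ⟨g, hg, -, hgm⟩ := lifts_and_natDegree_eq_and_monic hlift (monic_mul_leadingCoeff_inv hf)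
  refine ⟨g, hgm, ?_⟩
  rw [← aeval_map_algebraMap (ZMod p), show algebraMap ℤ (ZMod p) = Int.castRingHom _ from rfl,
    hg, map_mul, hf0, zero_mul]

theorem entStar_eq_top_of_forall_aeval_ne_zero (hG : IsBounded G) (φ : G →+ G)
    (h : ∀ f : ℤ[X], f.Monic → aeval (φ.toIntLinearMap : Module.End ℤ G) f ≠ 0) :
    entStar φ = ⊤ := by
  obtain ⟨m, hm, hmG⟩ := hG
  obtain ⟨p, hp, hpf⟩ : ∃ p : ℕ, p.Prime ∧ ∀ f : ℤ[X], f.Monic →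
      ∃ x, ∀ y, aeval (φ.toIntLinearMap : Module.End ℤ G) f x ≠ p • y := by
    by_contra! hcon
    obtain ⟨f, hf, hf'⟩ := exists_monic_forall_aeval_eq_nsmul φ.toIntLinearMap hcon m hm.ne'
    refine h f hf (LinearMap.ext fun x => ?_)
    obtain ⟨y, hy⟩ := hf' x
    rw [hy, hmG, LinearMap.zero_apply]
  have := Fact.mk hp
  let P : AddSubgroup G := (nsmulAddMonoidHom p).range
  have hP : IsInvariant φ P := by
    rintro _ ⟨y, rfl⟩
    exact ⟨φ y, (map_nsmul φ p y).symm⟩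
  let _ : Module (ZMod p) (G ⧸ P) := QuotientAddGroup.zmodModule fun x => ⟨x, rfl⟩
  let T : Module.End (ZMod p) (G ⧸ P) := (induced φ P hP).toZModLinearMap p
  refine entStar_eq_top_of_semiconj φ T (QuotientAddGroup.mk' P)
    (QuotientAddGroup.mk'_surjective P) (fun _ => rfl) fun f hf hf0 => ?_
  obtain ⟨g, hgm, hgT⟩ := exists_monic_int_aeval_eq_zero T hf hf0
  obtain ⟨x, hx⟩ := hpf g hgm
  have h1 := map_aeval_of_semiconj (QuotientAddGroup.mk' P).toIntLinearMap φ.toIntLinearMap T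
    (fun _ => rfl) g x
  rw [hgT] at h1
  obtain ⟨y, hy⟩ := (QuotientAddGroup.eq_zero_iff _).1 h1
  exact hx y hy.symm

end Entropy

end AdjointEntropy

/-! ### Additivity -/

open AdjointEntropy in
theorem mainTheorem7 {G : Type*} [AddCommGroup G] (hG : AdjointEntropy.IsBounded G)
    (φ : G →+ G) (H : AddSubgroup G) (hH : AdjointEntropy.IsInvariant φ H) :
    AdjointEntropy.entStar φ =
      AdjointEntropy.entStar (AdjointEntropy.restrict φ H hH) +
        AdjointEntropy.entStar (AdjointEntropy.induced φ H hH) := by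
  have hsub (f : ℤ[X]) (x : H) :=
    map_aeval_of_semiconj H.subtype.toIntLinearMap (restrict φ H hH).toIntLinearMap
      φ.toIntLinearMap (fun _ => rfl) f x
  have hquo (f : ℤ[X]) (x : G) :=
    map_aeval_of_semiconj (QuotientAddGroup.mk' H).toIntLinearMap φ.toIntLinearMap
      (induced φ H hH).toIntLinearMap (fun _ => rfl) f x
  by_cases h : ∃ f : ℤ[X], f.Monic ∧ aeval (φ.toIntLinearMap : Module.End ℤ G) f = 0
  · obtain ⟨f, hf, hf0⟩ := h
    rw [entStar_eq_zero_of_aeval_eq_zero φ hf hf0, entStar_eq_zero_of_aeval_eq_zero _ hf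
      (LinearMap.ext fun x => Subtype.ext ?_), entStar_eq_zero_of_aeval_eq_zero _ hf
      (LinearMap.ext fun x => ?_), add_zero]
    · obtain ⟨y, rfl⟩ := QuotientAddGroup.mk'_surjective H x
      have := hquo f y
      rw [hf0] at this
      exact this.symm
    · have := hsub f x
      rw [hf0] at this
      exact this
  · push Not at h
    rw [entStar_eq_top_of_forall_aeval_ne_zero hG φ h]
    obtain ⟨m, hm, hmG⟩ := hG
    symm
    rw [ENNReal.add_eq_top]
    by_contra! hcon
    have hex₁ : ∃ g : ℤ[X], g.Monic ∧
        aeval ((restrict φ H hH).toIntLinearMap : Module.End ℤ H) g = 0 := by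
      by_contra! hg
      exact hcon.1 (entStar_eq_top_of_forall_aeval_ne_zero
        ⟨m, hm, fun x => Subtype.ext (hmG x)⟩ _ hg)
    have hex₂ : ∃ f : ℤ[X], f.Monic ∧
        aeval ((induced φ H hH).toIntLinearMap : Module.End ℤ (G ⧸ H)) f = 0 := by
      by_contra! hf
      refine hcon.2 (entStar_eq_top_of_forall_aeval_ne_zero ⟨m, hm, fun x => ?_⟩ _ hf)
      obtain ⟨y, rfl⟩ := QuotientAddGroup.mk'_surjective H x
      rw [← map_nsmul, hmG, map_zero]
    obtain ⟨g, hg, hg0⟩ := hex₁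
    obtain ⟨f, hf, hf0⟩ := hex₂
    -- `f` kills the quotient, so it moves `G` into `H`, where `g` vanishes.
    refine h (g * f) (hg.mul hf) (LinearMap.ext fun x => ?_)
    have hfx : aeval (φ.toIntLinearMap : Module.End ℤ G) f x ∈ H := by
      have := hquo f x
      rw [hf0] at this
      exact (QuotientAddGroup.eq_zero_iff _).1 this
    have := hsub g ⟨_, hfx⟩
    rw [hg0] at this
    rw [map_mul]
    exact this.symm
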